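/- A $3$-uniform hypergraph is a finite vertex set together with a set of $3$-element subsets of it, called edges. For natural numbers $n, v, e$ with $e\ge 1$, let $f(n,v,e)$ denote the maximum number of edges in a $3$-uniform hypergraph on $n$ vertices which does not contain a $(v,e)$-configuration, that is, which has no subhypergraph with at most $v$ vertices and at least $e$ edges. **Theorem.** For every integer $e\ge 3$ there exists $\varepsilon=\varepsilon(e)>0$ such that $$f\bigl(n,\ e+\lfloor\log_2 e\rfloor+38,\ e\bigr)=O\bigl(n^{2-\varepsilon}\bigr)\qquad (n\to\infty),$$ where the implied constant may depend on $e$. Equivalently, with the same $\varepsilon$, there is a constant $C=C(e)>0$ such that for every $n\ge 1$, every $3$-uniform hypergraph with $n$ vertices and at least $C\,n^{2-\varepsilon}$ edges contains $e$ edges whose union has at most $e+\lfloor\log_2 e\rfloor+38$ vertices. -/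

import Mathlib

/-- A `3`-uniform hypergraph on the vertex set `V`, given by its set of edges: every edge is a set of
exactly three vertices (no repeated edges). -/
def IsThreeUniform {V : Type*} (H : Finset (Finset V)) : Prop :=
  (H : Set (Finset V)).Sized 3

/-- `H` contains a `(v, e)`-configuration: a subhypergraph, with vertex set `S` and edge set `E`,
that has at most `v` vertices and at least `e` edges. -/
def ContainsConfiguration {V : Type*} (H : Finset (Finset V)) (v e : ℕ) : Prop :=
  ∃ (S : Finset V) (E : Finset (Finset V)),
    E ⊆ H ∧ (∀ A ∈ E, A ⊆ S) ∧ S.card ≤ v ∧ e ≤ E.card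

open Classical in
/-- `brownErdosSos n v e` is the function `f(n, v, e)`: the maximum number of edges in a `3`-uniform
hypergraph on `n` vertices which does not contain a `(v, e)`-configuration. The maximum is over a
finite family, which for `1 ≤ e` contains the hypergraph without edges. -/
noncomputable def brownErdosSos (n v e : ℕ) : ℕ :=
  ((Finset.univ : Finset (Finset (Finset (Fin n)))).filter
    fun H => IsThreeUniform H ∧ ¬ ContainsConfiguration H v e).sup Finset.card

/-- For `1 ≤ e` the value `brownErdosSos n v e` is a maximum that is attained. -/
theorem isGreatest_brownErdosSos (n v e : ℕ) (he : 1 ≤ e) :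
    IsGreatest {m : ℕ | ∃ H : Finset (Finset (Fin n)),
      IsThreeUniform H ∧ ¬ ContainsConfiguration H v e ∧ H.card = m} (brownErdosSos n v e) := by
  classical
  constructor
  · have hne : ((Finset.univ : Finset (Finset (Finset (Fin n)))).filter
        fun H => IsThreeUniform H ∧ ¬ ContainsConfiguration H v e).Nonempty := by
      refine ⟨∅, ?_⟩
      simp only [Finset.mem_filter, Finset.mem_univ, true_and]
      refine ⟨by simp [IsThreeUniform], ?_⟩
      rintro ⟨S, E, hE, -, -, hc⟩
      rw [Finset.subset_empty.mp hE, Finset.card_empty] at hc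
      omega
    obtain ⟨H, hH, hm⟩ := Finset.exists_mem_eq_sup _ hne Finset.card
    simp only [Finset.mem_filter, Finset.mem_univ, true_and] at hH
    refine ⟨H, hH.1, hH.2, ?_⟩
    rw [← hm, brownErdosSos]
  · rintro m ⟨H, h1, h2, rfl⟩
    unfold brownErdosSos
    exact Finset.le_sup (f := Finset.card) (by simp [h1, h2])

/-! Dense configurations come from repeatedly doubling a small `3`-graph. A `Gadget` has `|E| + d`
vertices and a root `T` of `d - 1` vertices; the root and one pendant vertex generate everything, so
in a linear host a homomorphism is fixed by `d` values. Gluing two copies along `T`, with `t`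
replaced by a pendant `z`, doubles `|E|` but raises `d` only by one (`Gadget.double`). From a single
edge, `k` doublings give `2 ^ k` edges and `d = k + 2`, hence a logarithmic excess.

By Cauchy–Schwarz, `n ^ d / Y` injective homomorphisms give about `n ^ (d + 1) / Y ^ 2` pairs
agreeing on the glued set. Pairs in which the second copy of `t` hits the first copy are `O(n ^ d)`.
By `IsPendant.injective_or_card_image_le`, every other pair is an injective homomorphism of the
double or collapses, saving at least one vertex relative to its edges. If collapsed maps abound,
many agree on the root; edge-disjoint ones are then united greedily, each adding no more vertices
than edges, which already gives a dense family (`hasDenseFamily_of_star`). Otherwise the induction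
`IsPendant.isAbundant_double` continues, and one injective gadget with `2 ^ k ≥ e` edges suffices.

Linearity is free: a pair in `e` edges is itself dense, and otherwise a maximal linear subfamily
keeps a constant proportion of the edges. -/

/-- `A` spans the `3`-graph `E` if the only set containing `A` that contains the third vertex of
every edge of which it contains two vertices is the set of all vertices. -/
def Spans {V : Type*} [DecidableEq V] (E : Finset (Finset V)) (A : Finset V) : Prop :=
  ∀ X : Finset V, A ⊆ X → (∀ f ∈ E, 2 ≤ (f ∩ X).card → f ⊆ X) → ∀ v, v ∈ X

/-- Any two distinct edges share at most one vertex. -/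
def IsLinearFamily {W : Type*} [DecidableEq W] (H : Finset (Finset W)) : Prop :=
  ∀ A ∈ H, ∀ B ∈ H, 2 ≤ (A ∩ B).card → A = B

/-- `φ` maps edges of `E` to edges of `H`. -/
def IsEdgeHom {V W : Type*} [DecidableEq W] (E : Finset (Finset V)) (H : Finset (Finset W))
    (φ : V → W) : Prop :=
  ∀ f ∈ E, f.image φ ∈ H

/-- There are exactly `e` edges of `H` spanning at most `v` vertices. -/
def HasDenseFamily {W : Type*} [DecidableEq W] (H : Finset (Finset W)) (v e : ℕ) : Prop :=
  ∃ E : Finset (Finset W), E ⊆ H ∧ E.card = e ∧ (E.biUnion id).card ≤ v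

/-! ### Spanning sets and homomorphisms into linear `3`-graphs -/

section Basic

variable {V W : Type*} [DecidableEq W]

theorem IsEdgeHom.injOn {E : Finset (Finset V)} {H : Finset (Finset W)} {φ : V → W}
    (hφ : IsEdgeHom E H φ) (hE : ∀ f ∈ E, f.card = 3) (hH : ∀ f ∈ H, f.card = 3)
    {f : Finset V} (hf : f ∈ E) : Set.InjOn φ f := by
  rw [← Finset.card_image_iff, hE f hf, hH _ (hφ f hf)]

/-- The edges of the image of `φ`. -/
def imageEdges (E : Finset (Finset V)) (φ : V → W) : Finset (Finset W) :=
  E.image fun f => f.image φ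

theorem mem_imageEdges {E : Finset (Finset V)} {φ : V → W} {g : Finset W} :
    g ∈ imageEdges E φ ↔ ∃ f ∈ E, f.image φ = g := by
  simp [imageEdges]

theorem HasDenseFamily.mono {H H' : Finset (Finset W)} {v v' e : ℕ} (h : HasDenseFamily H v e)
    (hH : H ⊆ H') (hv : v ≤ v') : HasDenseFamily H' v' e := by
  obtain ⟨E, h1, h2, h3⟩ := h
  exact ⟨E, h1.trans hH, h2, h3.trans hv⟩

theorem IsEdgeHom.imageEdges_subset {E : Finset (Finset V)} {H : Finset (Finset W)} {φ : V → W}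
    (hφ : IsEdgeHom E H φ) : imageEdges E φ ⊆ H := by
  intro g hg
  obtain ⟨f, hf, rfl⟩ := mem_imageEdges.1 hg
  exact hφ f hf

theorem subset_image_of_mem_imageEdges [Fintype V] {E : Finset (Finset V)} {φ : V → W}
    {g : Finset W} (hg : g ∈ imageEdges E φ) : g ⊆ Finset.univ.image φ := by
  obtain ⟨f, hf, rfl⟩ := mem_imageEdges.1 hg
  exact Finset.image_subset_image (Finset.subset_univ f)

/-- Edges can be added one at a time, each bringing at most one new vertex. -/
theorem exists_subfamily_card_union_le {A : Finset W} {F : Finset (Finset W)}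
    (hF : ∀ f ∈ F, f.card = 3)
    (hA : ∀ X : Finset W, A ⊆ X → (∀ f ∈ F, 2 ≤ (f ∩ X).card → f ⊆ X) → ∀ f ∈ F, f ⊆ X) :
    ∀ j ≤ F.card, ∃ G ⊆ F, G.card = j ∧ (A ∪ G.biUnion id).card ≤ A.card + j := by
  intro j
  induction j with
  | zero => exact fun _ => ⟨∅, by simp, by simp, by simp⟩
  | succ j ih =>
    intro hj
    obtain ⟨G, hG, hc, hle⟩ := ih (by omega)
    set X := A ∪ G.biUnion id with hX
    -- If every unused edge met `X` in at most one vertex, `X` would be closed and so would contain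
    -- all of `F`.
    have hex : ∃ f ∈ F, f ∉ G ∧ 2 ≤ (f ∩ X).card := by
      by_contra! hno
      obtain ⟨f, hf, hfG⟩ := Finset.exists_mem_notMem_of_card_lt_card (s := G) (t := F) (by omega)
      have hclosed := hA X Finset.subset_union_left (fun g hg h2 => by
        by_cases hgG : g ∈ G
        · exact (Finset.subset_biUnion_of_mem id hgG).trans Finset.subset_union_right
        · exact absurd h2 (not_le.2 (hno g hg hgG))) f hf
      have := hno f hf hfG
      rw [Finset.inter_eq_left.2 hclosed, hF f hf] at this
      omega
    obtain ⟨f, hf, hfG, h2⟩ := hex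
    refine ⟨insert f G, Finset.insert_subset hf hG, by rw [Finset.card_insert_of_notMem hfG, hc], ?_⟩
    have hsub : A ∪ (insert f G).biUnion id ⊆ X ∪ (f \ X) := by
      rw [Finset.union_sdiff_self_eq_union, Finset.biUnion_insert, hX]
      intro w
      simp only [Finset.mem_union, id]
      tauto
    have h3 := Finset.card_sdiff_add_card_inter f X
    rw [hF f hf] at h3
    calc _ ≤ _ := Finset.card_le_card hsub
      _ ≤ X.card + (f \ X).card := Finset.card_union_le _ _
      _ ≤ _ := by omega

variable [DecidableEq V]

/-- A homomorphism into a linear `3`-graph is determined by its values on a spanning set. -/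
theorem IsEdgeHom.ext_of_spans {E : Finset (Finset V)} {H : Finset (Finset W)} [Fintype V]
    {φ ψ : V → W}
    (hφ : IsEdgeHom E H φ) (hψ : IsEdgeHom E H ψ) (hE : ∀ f ∈ E, f.card = 3)
    (hH : ∀ f ∈ H, f.card = 3) (hlin : IsLinearFamily H) {A : Finset V} (hA : Spans E A)
    (h : ∀ a ∈ A, φ a = ψ a) : φ = ψ := by
  have key := hA (Finset.univ.filter fun v => φ v = ψ v) (fun a ha => by simp [h a ha]) ?_
  · funext v
    simpa using key v
  intro f hf h2
  have iφ := hφ.injOn hE hH hf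
  set X := Finset.univ.filter fun v => φ v = ψ v with hX
  -- Two vertices of agreement put two common vertices in both image edges, so linearity identifies
  -- them.
  have himg : f.image φ = f.image ψ := by
    refine hlin _ (hφ f hf) _ (hψ f hf) (h2.trans ?_)
    rw [← Finset.card_image_of_injOn (s := f ∩ X) (f := φ)
      (iφ.mono (by simp))]
    refine Finset.card_le_card fun w hw => ?_
    obtain ⟨u, hu, rfl⟩ := Finset.mem_image.1 hw
    rw [Finset.mem_inter] at hu
    have hu2 : φ u = ψ u := by simpa [hX] using hu.2
    exact Finset.mem_inter.2 ⟨Finset.mem_image_of_mem _ hu.1,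
      hu2 ▸ Finset.mem_image_of_mem _ hu.1⟩
  intro v hv
  by_contra hvX
  have hmem : φ v ∈ f.image ψ := himg ▸ Finset.mem_image_of_mem φ hv
  obtain ⟨u, hu, huv⟩ := Finset.mem_image.1 hmem
  -- If `u` is in `X`, injectivity forces `u = v`; otherwise `u` and `v` both miss `X`, too many for
  -- an edge with two vertices in `X`.
  by_cases huX : u ∈ X
  · have hu2 : φ u = ψ u := by simpa [hX] using huX
    have : u = v := iφ hu hv (hu2.trans huv)
    exact hvX (this ▸ huX)
  · have huv' : u ≠ v := by
      rintro rfl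
      exact huX (by simp [hX, huv])
    have hsub : ({u, v} : Finset V) ⊆ f \ X := by
      intro w hw
      simp only [Finset.mem_insert, Finset.mem_singleton] at hw
      rcases hw with rfl | rfl <;> exact Finset.mem_sdiff.2 ⟨‹_›, ‹_›⟩
    have h3 := Finset.card_le_card hsub
    rw [Finset.card_pair huv'] at h3
    have h4 := Finset.card_sdiff_add_card_inter f X
    rw [hE f hf] at h4
    omega

/-- The image of a spanning set generates the image of a homomorphism. -/
theorem IsEdgeHom.image_subset_of_closed {E : Finset (Finset V)} {H : Finset (Finset W)}
    [Fintype V] {φ : V → W}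
    (hφ : IsEdgeHom E H φ) (hE : ∀ f ∈ E, f.card = 3) (hH : ∀ f ∈ H, f.card = 3)
    {A : Finset V} (hA : Spans E A) {X : Finset W} (hAX : A.image φ ⊆ X)
    (hX : ∀ f ∈ E, 2 ≤ (f.image φ ∩ X).card → f.image φ ⊆ X) (v : V) : φ v ∈ X := by
  have := hA (Finset.univ.filter fun v => φ v ∈ X)
    (fun a ha => by simpa using hAX (Finset.mem_image_of_mem φ ha)) ?_ v
  · simpa using this
  intro f hf h2 u hu
  have h3 := hX f hf (h2.trans ?_) (Finset.mem_image_of_mem φ hu)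
  · simpa using h3
  rw [← Finset.card_image_of_injOn (s := f ∩ _) (f := φ)
    ((hφ.injOn hE hH hf).mono (by simp))]
  refine Finset.card_le_card fun w hw => ?_
  obtain ⟨u, hu, rfl⟩ := Finset.mem_image.1 hw
  simp only [Finset.mem_inter, Finset.mem_filter, Finset.mem_univ, true_and] at hu
  exact Finset.mem_inter.2 ⟨Finset.mem_image_of_mem _ hu.1, hu.2⟩

theorem IsEdgeHom.exists_subfamily {E : Finset (Finset V)} {H : Finset (Finset W)}
    [Fintype V] {φ : V → W}
    (hφ : IsEdgeHom E H φ) (hE : ∀ f ∈ E, f.card = 3) (hH : ∀ f ∈ H, f.card = 3)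
    {A : Finset V} (hA : Spans E A) {B : Finset W} (hAB : A.image φ ⊆ B) {j : ℕ}
    (hj : j ≤ (imageEdges E φ).card) :
    ∃ G ⊆ imageEdges E φ, G.card = j ∧ (B ∪ G.biUnion id).card ≤ B.card + j := by
  refine exists_subfamily_card_union_le (fun f hf => hH f (hφ.imageEdges_subset hf)) ?_ j hj
  intro X hBX hX g hg
  obtain ⟨f, hf, rfl⟩ := mem_imageEdges.1 hg
  intro w hw
  obtain ⟨v, -, rfl⟩ := Finset.mem_image.1 hw
  exact hφ.image_subset_of_closed hE hH hA (hAB.trans hBX)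
    (fun f hf => hX _ (mem_imageEdges.2 ⟨f, hf, rfl⟩)) v

/-- If `B` contains the image of a spanning set then the vertices of the image outside `B` are
at most as many as the edges of the image not inside `B`. -/
theorem IsEdgeHom.card_image_le {E : Finset (Finset V)} {H : Finset (Finset W)}
    [Fintype V] {φ : V → W}
    (hφ : IsEdgeHom E H φ) (hE : ∀ f ∈ E, f.card = 3) (hH : ∀ f ∈ H, f.card = 3)
    {A : Finset V} (hA : Spans E A) {B : Finset W} (hAB : A.image φ ⊆ B)
    {F : Finset (Finset W)} (hF : ∀ g ∈ F, g ⊆ B) :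
    (Finset.univ.image φ).card ≤ B.card + (imageEdges E φ \ F).card := by
  have hmem : ∀ X : Finset W, B ⊆ X →
      (∀ g ∈ imageEdges E φ \ F, 2 ≤ (g ∩ X).card → g ⊆ X) → ∀ v, φ v ∈ X := by
    intro X hBX hX v
    refine hφ.image_subset_of_closed hE hH hA (hAB.trans hBX) (fun f hf h2 => ?_) v
    by_cases hfF : f.image φ ∈ F
    · exact (hF _ hfF).trans hBX
    · exact hX _ (Finset.mem_sdiff.2 ⟨mem_imageEdges.2 ⟨f, hf, rfl⟩, hfF⟩) h2
  obtain ⟨G, hG, hc, hle⟩ := exists_subfamily_card_union_le (A := B) (F := imageEdges E φ \ F)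
    (fun f hf => hH f (hφ.imageEdges_subset (Finset.mem_sdiff.1 hf).1)) (by
      intro X hBX hX g hg w hw
      have := subset_image_of_mem_imageEdges (Finset.mem_sdiff.1 hg).1 hw
      obtain ⟨v, -, rfl⟩ := Finset.mem_image.1 this
      exact hmem X hBX hX v) _ le_rfl
  refine (Finset.card_le_card ?_).trans hle
  intro w hw
  obtain ⟨v, -, rfl⟩ := Finset.mem_image.1 hw
  refine hmem _ Finset.subset_union_left (fun g hg _ => ?_) v
  have : G = imageEdges E φ \ F := Finset.eq_of_subset_of_card_le hG hc.ge
  exact (Finset.subset_biUnion_of_mem id (this ▸ hg)).trans Finset.subset_union_right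

end Basic

/-! ### Gadgets and their doubling -/

/-- `z` lies in exactly one edge `f` of `E`, and this edge contains the element `t` of `T ∌ z`. -/
structure IsPendant {V : Type*} (E : Finset (Finset V)) (T : Finset V) (z t : V)
    (f : Finset V) : Prop where
  notMem : z ∉ T
  mem : t ∈ T
  edge_mem : f ∈ E
  mem_edge : z ∈ f
  root_mem_edge : t ∈ f
  unique : ∀ g ∈ E, z ∈ g → g = f

/-- A `3`-graph with `|E| + d` vertices and a set `T` of `d - 1` vertices that spans everything
together with any edge, and for which there are two pendant vertices. -/
structure Gadget {V : Type*} [Fintype V] [DecidableEq V] (E : Finset (Finset V)) (T : Finset V)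
    (d : ℕ) : Prop where
  card_edge : ∀ f ∈ E, f.card = 3
  card_root : T.card + 1 = d
  card_vertex : Fintype.card V = E.card + d
  nonempty : E.Nonempty
  spans : ∀ f ∈ E, Spans E (T ∪ f)
  card_inter_le : ∀ f ∈ E, (f ∩ T).card ≤ 1
  pendant : ∃ z t f z' t' f', z ≠ z' ∧ IsPendant E T z t f ∧ IsPendant E T z' t' f'

section DoubleEdges

variable {V V' : Type*} [DecidableEq V'] {i j : V → V'}

/-- The edges of the double. -/
def doubleEdges (E : Finset (Finset V)) (i j : V → V') : Finset (Finset V') :=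
  imageEdges E i ∪ imageEdges E j

theorem mem_doubleEdges {E : Finset (Finset V)} {g : Finset V'} :
    g ∈ doubleEdges E i j ↔ (∃ f ∈ E, f.image i = g) ∨ ∃ f ∈ E, f.image j = g := by
  simp [doubleEdges, mem_imageEdges]

end DoubleEdges

/-- `V'` is the union of two copies of `V` that share exactly the copies of `S`. -/
structure IsDouble {V V' : Type*} (S : Finset V) (i j : V → V') : Prop where
  inj_left : Function.Injective i
  inj_right : Function.Injective j
  eq_iff : ∀ a b, i a = j b ↔ a = b ∧ a ∈ S
  cover : ∀ v, (∃ a, i a = v) ∨ ∃ a, j a = v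

theorem IsDouble.card {V V' : Type*} [DecidableEq V'] [Fintype V] [Fintype V'] {S : Finset V}
    {i j : V → V'} (h : IsDouble S i j) : Fintype.card V' + S.card = 2 * Fintype.card V := by
  have h1 : (Finset.univ : Finset V') = Finset.univ.image i ∪ Finset.univ.image j := by
    ext v
    simpa using h.cover v
  have h2 : Finset.univ.image i ∩ Finset.univ.image j = S.image i := by
    ext v
    simp only [Finset.mem_inter, Finset.mem_image, Finset.mem_univ, true_and]
    constructor
    · rintro ⟨⟨a, rfl⟩, b, hb⟩
      exact ⟨a, ((h.eq_iff a b).1 hb.symm).2, rfl⟩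
    · rintro ⟨a, ha, rfl⟩
      exact ⟨⟨a, rfl⟩, a, ((h.eq_iff a a).2 ⟨rfl, ha⟩).symm⟩
  have h3 := Finset.card_union_add_card_inter (Finset.univ.image i) (Finset.univ.image j)
  rw [← h1, h2, Finset.card_image_of_injective _ h.inj_left,
    Finset.card_image_of_injective _ h.inj_left, Finset.card_image_of_injective _ h.inj_right,
    Finset.card_univ, Finset.card_univ] at h3
  omega

section Double

variable {V : Type*} [DecidableEq V]

/-- An edge has at most one vertex in `T`, and `z` supplies at most one more. Hence the two copies
in a double share no edge. -/
theorem not_edge_subset_glue {E : Finset (Finset V)} {T : Finset V}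
    (hE : ∀ f ∈ E, f.card = 3) (hT : ∀ f ∈ E, (f ∩ T).card ≤ 1) (z t : V) {f : Finset V}
    (hf : f ∈ E) : ¬ f ⊆ insert z (T.erase t) := by
  intro hsub
  have h1 : f ⊆ insert z (f ∩ T) := by
    intro v hv
    have := hsub hv
    simp only [Finset.mem_insert, Finset.mem_erase, Finset.mem_inter] at this ⊢
    tauto
  have := (Finset.card_le_card h1).trans (Finset.card_insert_le _ _)
  have h2 := hT f hf
  rw [hE f hf] at this
  omega

theorem exists_isDouble (S : Finset V) :
    ∃ i j : V → V ⊕ {v // v ∉ S}, IsDouble S i j := by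
  refine ⟨Sum.inl, fun v => if h : v ∈ S then Sum.inl v else Sum.inr ⟨v, h⟩,
    Sum.inl_injective, ?_, ?_, ?_⟩
  · intro a b h
    by_cases ha : a ∈ S <;> by_cases hb : b ∈ S <;> simp_all
  · intro a b
    by_cases hb : b ∈ S
    · simp only [hb, dif_pos, Sum.inl.injEq]
      constructor
      · rintro rfl
        exact ⟨rfl, hb⟩
      · exact fun h => h.1
    · simp only [hb, dif_neg, not_false_eq_true, reduceCtorEq, false_iff]
      rintro ⟨rfl, h⟩
      exact hb h
  · rintro (v | ⟨v, hv⟩)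
    · exact Or.inl ⟨v, rfl⟩
    · exact Or.inr ⟨v, by simp [hv]⟩

variable {V' : Type*} [DecidableEq V'] {S : Finset V} {i j : V → V'}

/-- A closed set of the double that contains a spanning set of one copy contains that copy. -/
theorem Spans.forall_left {E : Finset (Finset V)} (hi : Function.Injective i)
    {X : Finset V'} (hcl : ∀ f ∈ E, 2 ≤ (f.image i ∩ X).card → f.image i ⊆ X) {A : Finset V}
    (hA : Spans E A) (hAX : ∀ a ∈ A, i a ∈ X) (v : V) : i v ∈ X := by
  have := hA (X.preimage i hi.injOn) (fun a ha => by simpa using hAX a ha) ?_ v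
  · simpa using this
  intro f hf h2 u hu
  have h3 := hcl f hf (h2.trans ?_) (Finset.mem_image_of_mem i hu)
  · simpa using h3
  rw [← Finset.card_image_of_injective (f ∩ _) hi]
  refine Finset.card_le_card fun w hw => ?_
  obtain ⟨u, hu, rfl⟩ := Finset.mem_image.1 hw
  simp only [Finset.mem_inter, Finset.mem_preimage] at hu
  exact Finset.mem_inter.2 ⟨Finset.mem_image_of_mem _ hu.1, hu.2⟩

variable [Fintype V] [Fintype V']

/-- The vertices `z` and `t` force the pendant edge into any closed set, and the root together with
an edge spans. -/
theorem IsPendant.spans {E : Finset (Finset V)} {T : Finset V} {d : ℕ} (hG : Gadget E T d)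
    {z t : V} {f : Finset V} (hz : IsPendant E T z t f) : Spans E (insert z T) := by
  intro X hX hcl
  have hf : f ⊆ X := by
    refine hcl f hz.edge_mem ?_
    have hne : z ≠ t := fun h => hz.notMem (h ▸ hz.mem)
    rw [← Finset.card_pair hne]
    refine Finset.card_le_card ?_
    intro w hw
    simp only [Finset.mem_insert, Finset.mem_singleton] at hw
    rcases hw with rfl | rfl
    · exact Finset.mem_inter.2 ⟨hz.mem_edge, hX (Finset.mem_insert_self _ _)⟩
    · exact Finset.mem_inter.2 ⟨hz.root_mem_edge, hX (Finset.mem_insert_of_mem hz.mem)⟩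
  exact hG.spans f hz.edge_mem X
    (Finset.union_subset ((Finset.subset_insert _ _).trans hX) hf) hcl

theorem IsPendant.card_insert {E : Finset (Finset V)} {T : Finset V} {d : ℕ} (hG : Gadget E T d)
    {z t : V} {f : Finset V} (hz : IsPendant E T z t f) : (insert z T).card = d := by
  rw [Finset.card_insert_of_notMem hz.notMem, hG.card_root]

theorem IsPendant.card_glue {E : Finset (Finset V)} {T : Finset V} {d : ℕ} (hG : Gadget E T d)
    {z t : V} {f : Finset V} (hz : IsPendant E T z t f) :
    (insert z (T.erase t)).card + 1 = d := by
  rw [Finset.card_insert_of_notMem (fun h => hz.notMem (Finset.mem_of_mem_erase h)),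
    Finset.card_erase_add_one hz.mem, hG.card_root]

/-- The vertex count is `2 (|E| + d) - (d - 1) = 2 |E| + (d + 1)`. The second pendant vertex `z'` is
not glued, so its two copies are the pendant vertices of the double. -/
theorem Gadget.double {E : Finset (Finset V)} {T : Finset V} {d : ℕ} (hG : Gadget E T d)
    {z t z' t' : V} {f f' : Finset V} (hne : z ≠ z') (hz : IsPendant E T z t f)
    (hz' : IsPendant E T z' t' f') (h : IsDouble (insert z (T.erase t)) i j) :
    Gadget (doubleEdges E i j) (insert (j t) (T.image i)) (d + 1) ∧
      (doubleEdges E i j).card = 2 * E.card := by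
  have htz : t ≠ z := fun h => hz.notMem (h ▸ hz.mem)
  have ht : t ∉ insert z (T.erase t) := by simp [htz]
  have hjt : ∀ a, i a ≠ j t := fun a ha => ht (by
    obtain ⟨rfl, h2⟩ := (h.eq_iff a t).1 ha
    exact h2)
  have hshare : ∀ a ∈ insert z (T.erase t), i a = j a := fun a ha => (h.eq_iff a a).2 ⟨rfl, ha⟩
  have hglue := fun {g : Finset V} (hg : g ∈ E) =>
    not_edge_subset_glue hG.card_edge hG.card_inter_le z t hg
  have hTj : ∀ a ∈ T, j a ∈ insert (j t) (T.image i) := by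
    intro a ha
    by_cases hat : a = t
    · simp [hat]
    · rw [← hshare a (by simp [hat, ha])]
      exact Finset.mem_insert_of_mem (Finset.mem_image_of_mem i ha)
  have hcard : (doubleEdges E i j).card = 2 * E.card := by
    rw [doubleEdges, Finset.card_union_of_disjoint, imageEdges, imageEdges,
      Finset.card_image_of_injective _ (Finset.image_injective h.inj_left),
      Finset.card_image_of_injective _ (Finset.image_injective h.inj_right), two_mul]
    rw [Finset.disjoint_left]
    intro g hg1 hg2
    obtain ⟨g1, h1, rfl⟩ := mem_imageEdges.1 hg1
    obtain ⟨g2, h2, h12⟩ := mem_imageEdges.1 hg2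
    refine hglue h1 fun v hv => ?_
    have : i v ∈ g2.image j := h12 ▸ Finset.mem_image_of_mem i hv
    obtain ⟨u, -, hu⟩ := Finset.mem_image.1 this
    exact ((h.eq_iff v u).1 hu.symm).2
  have hjv : ∀ {v : V} {g : Finset V}, v ∉ insert z (T.erase t) → i v ∉ g.image j := by
    intro v g hv hm
    obtain ⟨u, -, hu⟩ := Finset.mem_image.1 hm
    exact hv ((h.eq_iff v u).1 hu.symm).2
  have hiv : ∀ {v : V} {g : Finset V}, v ∉ insert z (T.erase t) → j v ∉ g.image i := by
    intro v g hv hm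
    obtain ⟨u, -, hu⟩ := Finset.mem_image.1 hm
    obtain ⟨rfl, h2⟩ := (h.eq_iff u v).1 hu
    exact hv h2
  have hz'S : z' ∉ insert z (T.erase t) := by
    simp only [Finset.mem_insert, Finset.mem_erase, not_or, not_and]
    exact ⟨hne.symm, fun _ => hz'.notMem⟩
  refine ⟨⟨?_, ?_, ?_, ?_, ?_, ?_, ?_⟩, hcard⟩
  · intro g hg
    rcases mem_doubleEdges.1 hg with ⟨f, hf, rfl⟩ | ⟨f, hf, rfl⟩
    · rw [Finset.card_image_of_injective _ h.inj_left, hG.card_edge f hf]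
    · rw [Finset.card_image_of_injective _ h.inj_right, hG.card_edge f hf]
  · rw [Finset.card_insert_of_notMem, Finset.card_image_of_injective _ h.inj_left, hG.card_root]
    intro hm
    obtain ⟨a, -, ha⟩ := Finset.mem_image.1 hm
    exact hjt a ha
  · have h1 := h.card
    have h2 := hz.card_glue hG
    have h3 := hG.card_vertex
    rw [hcard]
    omega
  · obtain ⟨g, hg⟩ := hG.nonempty
    exact ⟨g.image i, mem_doubleEdges.2 (Or.inl ⟨g, hg, rfl⟩)⟩
  · intro g hg X hX hcl v
    have hcli : ∀ f ∈ E, 2 ≤ (f.image i ∩ X).card → f.image i ⊆ X :=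
      fun f hf => hcl _ (mem_doubleEdges.2 (Or.inl ⟨f, hf, rfl⟩))
    have hclj : ∀ f ∈ E, 2 ≤ (f.image j ∩ X).card → f.image j ⊆ X :=
      fun f hf => hcl _ (mem_doubleEdges.2 (Or.inr ⟨f, hf, rfl⟩))
    have hTX : ∀ a ∈ T, i a ∈ X := fun a ha => hX (Finset.mem_union_left _
      (Finset.mem_insert_of_mem (Finset.mem_image_of_mem i ha)))
    have hTX' : ∀ a ∈ T, j a ∈ X := fun a ha => hX (Finset.mem_union_left _ (hTj a ha))
    have hzS : z ∈ insert z (T.erase t) := Finset.mem_insert_self _ _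
    -- The copy containing the given edge is spanned first; it passes the shared vertex `z` to the
    -- other copy, where `z` and the root span.
    have hall : (∀ v, i v ∈ X) ∧ ∀ v, j v ∈ X := by
      rcases mem_doubleEdges.1 hg with ⟨f, hf, rfl⟩ | ⟨f, hf, rfl⟩
      · have h1 : ∀ v, i v ∈ X := (hG.spans f hf).forall_left h.inj_left hcli (by
          intro a ha
          rcases Finset.mem_union.1 ha with ha | ha
          · exact hTX a ha
          · exact hX (Finset.mem_union_right _ (Finset.mem_image_of_mem i ha)))
        refine ⟨h1, (hz.spans hG).forall_left h.inj_right hclj ?_⟩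
        intro a ha
        rcases Finset.mem_insert.1 ha with rfl | ha
        · exact hshare a hzS ▸ h1 a
        · exact hTX' a ha
      · have h1 : ∀ v, j v ∈ X := (hG.spans f hf).forall_left h.inj_right hclj (by
          intro a ha
          rcases Finset.mem_union.1 ha with ha | ha
          · exact hTX' a ha
          · exact hX (Finset.mem_union_right _ (Finset.mem_image_of_mem j ha)))
        refine ⟨(hz.spans hG).forall_left h.inj_left hcli ?_, h1⟩
        intro a ha
        rcases Finset.mem_insert.1 ha with rfl | ha
        · exact (hshare a hzS).symm ▸ h1 a
        · exact hTX a ha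
    rcases h.cover v with ⟨a, rfl⟩ | ⟨a, rfl⟩
    · exact hall.1 a
    · exact hall.2 a
  · intro g hg
    rcases mem_doubleEdges.1 hg with ⟨f, hf, rfl⟩ | ⟨f, hf, rfl⟩
    · refine le_trans (le_trans (Finset.card_le_card (t := (f ∩ T).image i) ?_)
        Finset.card_image_le) (hG.card_inter_le f hf)
      intro w hw
      obtain ⟨hw1, hw2⟩ := Finset.mem_inter.1 hw
      obtain ⟨a, ha, rfl⟩ := Finset.mem_image.1 hw1
      rcases Finset.mem_insert.1 hw2 with hw2 | hw2
      · exact absurd hw2 (hjt a)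
      · obtain ⟨b, hb, hab⟩ := Finset.mem_image.1 hw2
        rw [h.inj_left hab] at hb
        exact Finset.mem_image_of_mem i (Finset.mem_inter.2 ⟨ha, hb⟩)
    · refine le_trans (le_trans (Finset.card_le_card (t := (f ∩ T).image j) ?_)
        Finset.card_image_le) (hG.card_inter_le f hf)
      intro w hw
      obtain ⟨hw1, hw2⟩ := Finset.mem_inter.1 hw
      obtain ⟨a, ha, rfl⟩ := Finset.mem_image.1 hw1
      rcases Finset.mem_insert.1 hw2 with hw2 | hw2
      · rw [h.inj_right hw2] at ha ⊢
        exact Finset.mem_image_of_mem j (Finset.mem_inter.2 ⟨ha, hz.mem⟩)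
      · obtain ⟨b, hb, hab⟩ := Finset.mem_image.1 hw2
        obtain ⟨rfl, -⟩ := (h.eq_iff b a).1 hab
        exact Finset.mem_image_of_mem j (Finset.mem_inter.2 ⟨ha, hb⟩)
  · refine ⟨i z', i t', f'.image i, j z', j t', f'.image j, ?_, ?_, ?_⟩
    · intro heq
      exact hz'S ((h.eq_iff _ _).1 heq).2
    · refine ⟨?_, Finset.mem_insert_of_mem (Finset.mem_image_of_mem i hz'.mem),
        mem_doubleEdges.2 (Or.inl ⟨f', hz'.edge_mem, rfl⟩),
        Finset.mem_image_of_mem i hz'.mem_edge, Finset.mem_image_of_mem i hz'.root_mem_edge, ?_⟩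
      · intro hm
        rcases Finset.mem_insert.1 hm with hm | hm
        · exact hjt _ hm
        · obtain ⟨b, hb, hab⟩ := Finset.mem_image.1 hm
          exact hz'.notMem (h.inj_left hab ▸ hb)
      · intro g hg hzg
        rcases mem_doubleEdges.1 hg with ⟨g₀, hg₀, rfl⟩ | ⟨g₀, hg₀, rfl⟩
        · obtain ⟨b, hb, hab⟩ := Finset.mem_image.1 hzg
          rw [hz'.unique g₀ hg₀ (h.inj_left hab ▸ hb)]
        · exact absurd hzg (hjv hz'S)
    · refine ⟨?_, hTj t' hz'.mem,
        mem_doubleEdges.2 (Or.inr ⟨f', hz'.edge_mem, rfl⟩),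
        Finset.mem_image_of_mem j hz'.mem_edge, Finset.mem_image_of_mem j hz'.root_mem_edge, ?_⟩
      · intro hm
        rcases Finset.mem_insert.1 hm with hm | hm
        · exact hz'.notMem (h.inj_right hm ▸ hz.mem)
        · obtain ⟨b, hb, hab⟩ := Finset.mem_image.1 hm
          obtain ⟨rfl, -⟩ := (h.eq_iff _ _).1 hab
          exact hz'.notMem hb
      · intro g hg hzg
        rcases mem_doubleEdges.1 hg with ⟨g₀, hg₀, rfl⟩ | ⟨g₀, hg₀, rfl⟩
        · exact absurd hzg (hiv hz'S)
        · obtain ⟨b, hb, hab⟩ := Finset.mem_image.1 hzg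
          rw [hz'.unique g₀ hg₀ (h.inj_right hab ▸ hb)]

end Double

/-- Cauchy–Schwarz for the fibre sizes of `g`. -/
theorem card_sq_le_card_mul_card_pairs {α β : Type*} [Fintype β] [DecidableEq β] (s : Finset α)
    (g : α → β) :
    s.card ^ 2 ≤ Fintype.card β * ((s ×ˢ s).filter fun p => g p.1 = g p.2).card := by
  have h1 : s.card = ∑ b, (s.filter fun a => g a = b).card :=
    Finset.card_eq_sum_card_fiberwise fun _ _ => Finset.mem_coe.2 (Finset.mem_univ _)
  have h2 : ((s ×ˢ s).filter fun p => g p.1 = g p.2).card =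
      ∑ b, (s.filter fun a => g a = b).card ^ 2 := by
    rw [Finset.card_eq_sum_card_fiberwise (f := fun p => g p.1) (t := Finset.univ)
      fun _ _ => Finset.mem_coe.2 (Finset.mem_univ _)]
    refine Finset.sum_congr rfl fun b _ => ?_
    rw [sq, ← Finset.card_product]
    congr 1
    ext ⟨x, y⟩
    simp only [Finset.mem_filter, Finset.mem_product]
    constructor
    · rintro ⟨⟨⟨hx, hy⟩, hxy⟩, hb⟩
      exact ⟨⟨hx, hb⟩, hy, hxy ▸ hb⟩
    · rintro ⟨⟨hx, hb⟩, hy, hb'⟩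
      exact ⟨⟨⟨hx, hy⟩, hb.trans hb'.symm⟩, hb⟩
  rw [h2]
  conv_lhs => rw [h1]
  exact sq_sum_le_card_mul_sum_sq

/-! ### Collapsed homomorphisms with a common root -/

section Star

variable {V W : Type*} [Fintype V] [DecidableEq V] [DecidableEq W]

/-- Few homomorphisms with prescribed values on a set `T` send some edge of `E` to an edge in a
given family, provided that `T` spans everything together with any edge. -/
theorem card_filter_imageEdges_le {E : Finset (Finset V)} {T : Finset V} {H : Finset (Finset W)}
    (hE : ∀ f ∈ E, f.card = 3) (hT : ∀ f ∈ E, Spans E (T ∪ f))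
    (hH : ∀ f ∈ H, f.card = 3) (hlin : IsLinearFamily H)
    {Φ : Finset (V → W)} (hΦ : ∀ φ ∈ Φ, IsEdgeHom E H φ)
    (hagree : ∀ φ ∈ Φ, ∀ ψ ∈ Φ, ∀ a ∈ T, φ a = ψ a) {F : Finset (Finset W)} (hF : F ⊆ H) :
    (Φ.filter fun φ => ¬ Disjoint F (imageEdges E φ)).card ≤ 27 * E.card * F.card := by
  have hsub : (Φ.filter fun φ => ¬ Disjoint F (imageEdges E φ)) ⊆
      (E ×ˢ F).biUnion fun p => Φ.filter fun φ => p.1.image φ = p.2 := by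
    intro φ hφ
    obtain ⟨h1, h2⟩ := Finset.mem_filter.1 hφ
    obtain ⟨g, hg, hg'⟩ := Finset.not_disjoint_iff.1 h2
    obtain ⟨f, hf, rfl⟩ := mem_imageEdges.1 hg'
    exact Finset.mem_biUnion.2 ⟨(f, _), Finset.mem_product.2 ⟨hf, hg⟩,
      Finset.mem_filter.2 ⟨h1, rfl⟩⟩
  refine (Finset.card_le_card hsub).trans ((Finset.card_biUnion_le_card_mul _ _ 27 ?_).trans ?_)
  · rintro ⟨f, g⟩ hfg
    obtain ⟨hf, hg⟩ := Finset.mem_product.1 hfg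
    -- A homomorphism is determined by its values on `T ∪ f`; those on `T` are fixed, leaving at
    -- most `3 ^ 3` maps `f → g`.
    have h27 : Fintype.card (f → g) = 27 := by
      simp [hE f hf, hH g (hF hg)]
    rw [← h27, ← Finset.card_univ]
    classical
    obtain ⟨w, hw⟩ : g.Nonempty := Finset.card_pos.1 (by rw [hH g (hF hg)]; norm_num)
    refine Finset.card_le_card_of_injOn
      (fun φ v => if h : φ v ∈ g then ⟨φ v, h⟩ else ⟨w, hw⟩)
      (fun _ _ => Finset.mem_coe.2 (Finset.mem_univ _)) ?_
    intro φ hφ ψ hψ hφψ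
    obtain ⟨h1, h2⟩ := Finset.mem_filter.1 (Finset.mem_coe.1 hφ)
    obtain ⟨h3, h4⟩ := Finset.mem_filter.1 (Finset.mem_coe.1 hψ)
    refine (hΦ φ h1).ext_of_spans (hΦ ψ h3) hE hH hlin (hT f hf) ?_
    intro a ha
    rcases Finset.mem_union.1 ha with ha | ha
    · exact hagree φ h1 ψ h3 a ha
    · have h5 : φ a ∈ g := by
        have h7 : f.image φ = g := h2
        exact h7 ▸ Finset.mem_image_of_mem φ ha
      have h6 : ψ a ∈ g := by
        have h7 : f.image ψ = g := h4
        exact h7 ▸ Finset.mem_image_of_mem ψ ha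
      have := congrFun hφψ ⟨a, ha⟩
      simpa [h5, h6] using this
  · rw [Finset.card_product]
    exact le_of_eq (by ring)

/-- Many homomorphisms agreeing on `T` whose images have few vertices give a dense family. -/
theorem hasDenseFamily_of_star {E : Finset (Finset V)} {T : Finset V} {H : Finset (Finset W)}
    {d e : ℕ} (hG : Gadget E T d) (hH : ∀ f ∈ H, f.card = 3) (hlin : IsLinearFamily H)
    {Φ : Finset (V → W)} (hΦ : ∀ φ ∈ Φ, IsEdgeHom E H φ)
    (hagree : ∀ φ ∈ Φ, ∀ ψ ∈ Φ, ∀ a ∈ T, φ a = ψ a)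
    (hinj : ∀ φ ∈ Φ, Set.InjOn φ T)
    (hfew : ∀ φ ∈ Φ, (Finset.univ.image φ).card + 1 ≤ (imageEdges E φ).card + d)
    (hcard : 27 * E.card * e < Φ.card) : HasDenseFamily H (e + d) e := by
  obtain ⟨φ₀, hφ₀⟩ : Φ.Nonempty := Finset.card_pos.1 (by omega)
  set R := T.image φ₀ with hR
  have hRφ : ∀ φ ∈ Φ, T.image φ = R := fun φ hφ =>
    Finset.image_congr fun a ha => hagree φ hφ φ₀ hφ₀ a ha
  have hRc : R.card + 1 = d := by
    rw [hR, Finset.card_image_of_injOn (hinj φ₀ hφ₀), hG.card_root]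
  -- A round may add several edges, so `k` only bounds `|F|` from below. The invariant is that `F`
  -- has at most `|F|` vertices outside `R`.
  have key : ∀ k ≤ e, HasDenseFamily H (e + d) e ∨ ∃ F ⊆ H, k ≤ F.card ∧ F.card ≤ e ∧
      (R ∪ F.biUnion id).card ≤ R.card + F.card := by
    intro k
    induction k with
    | zero => exact fun _ => Or.inr ⟨∅, by simp, by simp, by simp, by simp⟩
    | succ k ih =>
      intro hk
      rcases ih (by omega) with h | ⟨F, hF, hkF, hFe, hu⟩
      · exact Or.inl h
      rcases Nat.lt_or_ge k F.card with hlt | hge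
      · exact Or.inr ⟨F, hF, hlt, hFe, hu⟩
      have hconf := card_filter_imageEdges_le hG.card_edge hG.spans hH hlin hΦ hagree hF
      -- The at most `e` edges of `F` are hit by at most `27 |E| e` maps, fewer than are available.
      obtain ⟨φ, hφ, hdisj⟩ : ∃ φ ∈ Φ, Disjoint F (imageEdges E φ) := by
        by_contra! hno
        rw [Finset.filter_true_of_mem hno] at hconf
        have := Nat.mul_le_mul_left (27 * E.card) hFe
        omega
      rcases Nat.lt_or_ge e (F.card + (imageEdges E φ).card) with hbig | hsmall
      · left
        -- The whole image would overshoot `e`. Paying one extra vertex `φ z` makes the root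
        -- spanning, and exactly the missing edges are added singly; the total is `(d - 1) + 1 + e`.
        obtain ⟨z, t, f, -, -, -, -, hz, -⟩ := hG.pendant
        obtain ⟨G, hG', hGc, hGu⟩ := (hΦ φ hφ).exists_subfamily hG.card_edge hH (hz.spans hG)
          (B := insert (φ z) (R ∪ F.biUnion id)) (by
            rw [Finset.image_insert, hRφ φ hφ]
            exact Finset.insert_subset_insert _ Finset.subset_union_left)
          (j := e - F.card) (by omega)
        refine ⟨F ∪ G, Finset.union_subset hF (hG'.trans (hΦ φ hφ).imageEdges_subset), ?_, ?_⟩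
        · rw [Finset.card_union_of_disjoint (Finset.disjoint_of_subset_right hG' hdisj), hGc]
          omega
        · have h1 : (F ∪ G).biUnion id ⊆
              insert (φ z) (R ∪ F.biUnion id) ∪ G.biUnion id := by
            rw [Finset.union_biUnion]
            intro w
            simp only [Finset.mem_union, Finset.mem_insert]
            tauto
          have h2 := Finset.card_insert_le (φ z) (R ∪ F.biUnion id)
          have h3 := (Finset.card_le_card h1).trans hGu
          omega
      · right
        have hpos : 0 < (imageEdges E φ).card :=
          Finset.card_pos.2 (hG.nonempty.image _)
        refine ⟨F ∪ imageEdges E φ, Finset.union_subset hF (hΦ φ hφ).imageEdges_subset, ?_, ?_, ?_⟩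
        · rw [Finset.card_union_of_disjoint hdisj]
          omega
        · rw [Finset.card_union_of_disjoint hdisj]
          omega
        · rw [Finset.card_union_of_disjoint hdisj]
          -- Since `|R| = d - 1`, collapsing says that the image has at most as many vertices
          -- outside `R` as edges.
          have h1 : R ∪ (F ∪ imageEdges E φ).biUnion id ⊆
              (R ∪ F.biUnion id) ∪ (Finset.univ.image φ \ R) := by
            rw [Finset.union_biUnion]
            intro w hw
            by_cases hwR : w ∈ R
            · exact Finset.mem_union_left _ (Finset.mem_union_left _ hwR)
            simp only [Finset.mem_union, hwR, false_or] at hw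
            rcases hw with hw | hw
            · exact Finset.mem_union_left _ (Finset.mem_union_right _ hw)
            · obtain ⟨g, hg, hwg⟩ := Finset.mem_biUnion.1 hw
              exact Finset.mem_union_right _ (Finset.mem_sdiff.2
                ⟨subset_image_of_mem_imageEdges hg hwg, hwR⟩)
          have h2 := (Finset.card_le_card h1).trans (Finset.card_union_le _ _)
          have h3 : (Finset.univ.image φ \ R).card + R.card = (Finset.univ.image φ).card :=
            Finset.card_sdiff_add_card_eq_card
              (hRφ φ hφ ▸ Finset.image_subset_image (Finset.subset_univ T))
          have h4 := hfew φ hφ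
          omega
  rcases key e le_rfl with h | ⟨F, hF, h1, h2, h3⟩
  · exact h
  · refine ⟨F, hF, by omega, ?_⟩
    have := (Finset.card_le_card (Finset.subset_union_right (s₁ := R) (s₂ := F.biUnion id))).trans h3
    omega

end Star

/-! ### Gluing two homomorphisms: injective or collapsed -/

section Glue

variable {V V' W : Type*} {i j : V → V'}

theorem IsDouble.exists_glue {S : Finset V} (h : IsDouble S i j) {φ₁ φ₂ : V → W}
    (hS : ∀ a ∈ S, φ₁ a = φ₂ a) :
    ∃ φ : V' → W, (∀ a, φ (i a) = φ₁ a) ∧ ∀ a, φ (j a) = φ₂ a := by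
  have : ∀ v, ∃ w, (∀ a, i a = v → w = φ₁ a) ∧ ∀ a, j a = v → w = φ₂ a := by
    intro v
    rcases h.cover v with ⟨a, rfl⟩ | ⟨a, rfl⟩
    · refine ⟨φ₁ a, fun b hb => by rw [h.inj_left hb], fun b hb => ?_⟩
      obtain ⟨rfl, h2⟩ := (h.eq_iff a b).1 hb.symm
      exact hS a h2
    · refine ⟨φ₂ a, fun b hb => ?_, fun b hb => by rw [h.inj_right hb]⟩
      obtain ⟨rfl, h2⟩ := (h.eq_iff b a).1 hb
      exact (hS b h2).symm
  choose φ hφ using this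
  exact ⟨φ, fun a => (hφ _).1 a rfl, fun a => (hφ _).2 a rfl⟩

variable [DecidableEq V'] [DecidableEq W]

theorem imageEdges_doubleEdges (E : Finset (Finset V)) (φ : V' → W) :
    imageEdges (doubleEdges E i j) φ = imageEdges E (φ ∘ i) ∪ imageEdges E (φ ∘ j) := by
  simp only [imageEdges, doubleEdges, Finset.image_union, Finset.image_image]
  congr 1 <;> exact Finset.image_congr fun f _ => by simp [Finset.image_image]

variable [Fintype V] [DecidableEq V] [Fintype V']

/-- A homomorphism of the double that is injective on both copies, and for which the second copy
of `t` avoids the first copy, is injective or its image has few vertices. -/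
theorem IsPendant.injective_or_card_image_le {E : Finset (Finset V)} {T : Finset V}
    {H : Finset (Finset W)} {d : ℕ} (hG : Gadget E T d) {z t : V} {f : Finset V}
    (hz : IsPendant E T z t f) (h : IsDouble (insert z (T.erase t)) i j)
    (hH : ∀ f ∈ H, f.card = 3) {φ : V' → W}
    (hφ₂ : IsEdgeHom E H (φ ∘ j)) (h₁ : Function.Injective (φ ∘ i))
    (h₂ : Function.Injective (φ ∘ j)) (ht : ∀ v, φ (i v) ≠ φ (j t)) :
    Function.Injective φ ∨
      (Finset.univ.image φ).card ≤ (imageEdges (doubleEdges E i j) φ).card + d := by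
  set V₁ := Finset.univ.image (φ ∘ i) with hV₁
  set V₂ := Finset.univ.image (φ ∘ j) with hV₂
  have hshare : ∀ a ∈ insert z (T.erase t), φ (i a) = φ (j a) := fun a ha => by
    rw [(h.eq_iff a a).2 ⟨rfl, ha⟩]
  have hV : Finset.univ.image φ = V₁ ∪ V₂ := by
    ext w
    simp only [hV₁, hV₂, Finset.mem_image, Finset.mem_univ, true_and, Finset.mem_union,
      Function.comp_apply]
    constructor
    · rintro ⟨v, rfl⟩
      rcases h.cover v with ⟨a, rfl⟩ | ⟨a, rfl⟩
      · exact Or.inl ⟨a, rfl⟩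
      · exact Or.inr ⟨a, rfl⟩
    · rintro (⟨a, rfl⟩ | ⟨a, rfl⟩)
      · exact ⟨_, rfl⟩
      · exact ⟨_, rfl⟩
  have cV₁ : V₁.card = E.card + d := by
    rw [hV₁, Finset.card_image_of_injective _ h₁, Finset.card_univ, hG.card_vertex]
  have cV₂ : V₂.card = E.card + d := by
    rw [hV₂, Finset.card_image_of_injective _ h₂, Finset.card_univ, hG.card_vertex]
  have cE₁ : (imageEdges E (φ ∘ i)).card = E.card :=
    Finset.card_image_of_injective _ (Finset.image_injective h₁)
  have cE₂ : (imageEdges E (φ ∘ j)).card = E.card :=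
    Finset.card_image_of_injective _ (Finset.image_injective h₂)
  have cV := Finset.card_union_add_card_inter V₁ V₂
  have cE := Finset.card_union_add_card_inter (imageEdges E (φ ∘ i)) (imageEdges E (φ ∘ j))
  rw [hV, imageEdges_doubleEdges]
  have hSsub : (insert z (T.erase t)).image (φ ∘ i) ⊆ V₁ ∩ V₂ := by
    intro w hw
    obtain ⟨a, ha, rfl⟩ := Finset.mem_image.1 hw
    refine Finset.mem_inter.2 ⟨Finset.mem_image_of_mem _ (Finset.mem_univ a), ?_⟩
    rw [Function.comp_apply, hshare a ha]
    exact Finset.mem_image_of_mem (φ ∘ j) (Finset.mem_univ a)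
  have cS := hz.card_glue hG
  rw [← Finset.card_image_of_injective _ h₁] at cS
  rcases (imageEdges E (φ ∘ i) ∩ imageEdges E (φ ∘ j)).eq_empty_or_nonempty with he | ⟨g, hg⟩
  · rw [he, Finset.card_empty] at cE
    -- With no common edge, the glued set accounts for `d - 1` common vertices; any further one
    -- saves the required vertex.
    rcases Nat.lt_or_ge (V₁ ∩ V₂).card d with hlt | hge
    · left
      have hI : V₁ ∩ V₂ = (insert z (T.erase t)).image (φ ∘ i) :=
        (Finset.eq_of_subset_of_card_le hSsub (by omega)).symm
      have hcross : ∀ a b, φ (i a) = φ (j b) → i a = j b := by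
        intro a b hab
        have hmem : (φ ∘ i) a ∈ V₁ ∩ V₂ := by
          refine Finset.mem_inter.2 ⟨Finset.mem_image_of_mem _ (Finset.mem_univ a), ?_⟩
          rw [Function.comp_apply, hab]
          exact Finset.mem_image_of_mem (φ ∘ j) (Finset.mem_univ b)
        rw [hI] at hmem
        obtain ⟨c, hc, hca⟩ := Finset.mem_image.1 hmem
        obtain rfl := h₁ hca
        obtain rfl : c = b := h₂ ((hshare c hc).symm.trans hab)
        exact (h.eq_iff c c).2 ⟨rfl, hc⟩
      intro u v huv
      rcases h.cover u with ⟨a, rfl⟩ | ⟨a, rfl⟩ <;> rcases h.cover v with ⟨b, rfl⟩ | ⟨b, rfl⟩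
      · rw [h₁ huv]
      · exact hcross a b huv
      · exact (hcross b a huv.symm).symm
      · rw [h₂ huv]
    · right
      omega
  · right
    have hzshare : φ (i z) = φ (j z) := hshare z (Finset.mem_insert_self _ _)
    have hzI : φ (j z) ∈ V₁ ∩ V₂ := by
      rw [← hzshare]
      exact hSsub (Finset.mem_image_of_mem _ (Finset.mem_insert_self _ _))
    -- A common edge avoids `φ (j z)`: the only edge at `z` contains `t`, whose second image lies
    -- outside the first copy.
    have hF : ∀ g ∈ imageEdges E (φ ∘ i) ∩ imageEdges E (φ ∘ j),
        g ⊆ (V₁ ∩ V₂).erase (φ (j z)) := by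
      intro g hg w hw
      obtain ⟨hg₁, hg₂⟩ := Finset.mem_inter.1 hg
      refine Finset.mem_erase.2 ⟨?_, Finset.mem_inter.2
        ⟨subset_image_of_mem_imageEdges hg₁ hw, subset_image_of_mem_imageEdges hg₂ hw⟩⟩
      rintro rfl
      obtain ⟨f', hf', rfl⟩ := mem_imageEdges.1 hg₂
      obtain ⟨a, ha, haz⟩ := Finset.mem_image.1 hw
      obtain rfl : a = z := h₂ haz
      obtain rfl := hz.unique f' hf' ha
      have : (φ ∘ j) t ∈ V₁ := subset_image_of_mem_imageEdges hg₁
        (Finset.mem_image_of_mem (φ ∘ j) hz.root_mem_edge)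
      obtain ⟨v, -, hv⟩ := Finset.mem_image.1 this
      exact ht v hv
    obtain ⟨f₂, hf₂, hgf⟩ := mem_imageEdges.1 (Finset.mem_inter.1 hg).2
    -- Exchanging `φ (j z)` for `φ (j t)` keeps the size at most `|V₁ ∩ V₂|` and gives a set
    -- spanning the second copy, in which the common edges cost nothing.
    have hB : (T ∪ f₂).image (φ ∘ j) ⊆
        insert (φ (j t)) ((V₁ ∩ V₂).erase (φ (j z))) := by
      intro w hw
      obtain ⟨a, ha, rfl⟩ := Finset.mem_image.1 hw
      rcases Finset.mem_union.1 ha with ha | ha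
      · by_cases hat : a = t
        · rw [hat]
          exact Finset.mem_insert_self _ _
        · refine Finset.mem_insert_of_mem (Finset.mem_erase.2 ⟨?_, ?_⟩)
          · intro haz
            exact hz.notMem (h₂ haz ▸ ha)
          · have haS : a ∈ insert z (T.erase t) :=
              Finset.mem_insert_of_mem (Finset.mem_erase.2 ⟨hat, ha⟩)
            rw [Function.comp_apply, ← hshare a haS]
            exact hSsub (Finset.mem_image_of_mem _ haS)
      · refine Finset.mem_insert_of_mem (hF g hg ?_)
        rw [← hgf]
        exact Finset.mem_image_of_mem _ ha
    have h3 := hφ₂.card_image_le hG.card_edge hH (hG.spans f₂ hf₂) hB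
      (fun g hg => (hF g hg).trans (Finset.subset_insert _ _))
    have h4 := Finset.card_insert_le (φ (j t)) ((V₁ ∩ V₂).erase (φ (j z)))
    have h5 := Finset.card_erase_add_one hzI
    have h6 := Finset.card_sdiff_add_card_eq_card
      (Finset.inter_subset_right (s₁ := imageEdges E (φ ∘ i)) (s₂ := imageEdges E (φ ∘ j)))
    rw [← hV₂, cV₂] at h3
    omega

end Glue

/-! ### Counting injective and collapsed homomorphisms -/

section Counting

variable {V W : Type*} [Fintype V] [DecidableEq V] [Fintype W] [DecidableEq W]

open Classical in
/-- The injective homomorphisms. -/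
noncomputable def injHoms (E : Finset (Finset V)) (H : Finset (Finset W)) : Finset (V → W) :=
  Finset.univ.filter fun φ => IsEdgeHom E H φ ∧ Function.Injective φ

theorem mem_injHoms {E : Finset (Finset V)} {H : Finset (Finset W)} {φ : V → W} :
    φ ∈ injHoms E H ↔ IsEdgeHom E H φ ∧ Function.Injective φ := by
  simp [injHoms]

open Classical in
/-- Homomorphisms, injective on `T`, whose image has few vertices. -/
noncomputable def collapsedHoms (E : Finset (Finset V)) (T : Finset V) (d : ℕ)
    (H : Finset (Finset W)) : Finset (V → W) :=
  Finset.univ.filter fun φ => IsEdgeHom E H φ ∧ Set.InjOn φ T ∧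
    (Finset.univ.image φ).card + 1 ≤ (imageEdges E φ).card + d

theorem mem_collapsedHoms {E : Finset (Finset V)} {T : Finset V} {d : ℕ} {H : Finset (Finset W)}
    {φ : V → W} : φ ∈ collapsedHoms E T d H ↔ IsEdgeHom E H φ ∧ Set.InjOn φ T ∧
      (Finset.univ.image φ).card + 1 ≤ (imageEdges E φ).card + d := by
  simp [collapsedHoms]

/-- Pigeonhole over the restrictions to `T` produces a star. -/
theorem hasDenseFamily_of_card_collapsedHoms {E : Finset (Finset V)} {T : Finset V} {d e : ℕ}
    {H : Finset (Finset W)} (hG : Gadget E T d) (hH : ∀ f ∈ H, f.card = 3)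
    (hlin : IsLinearFamily H)
    (hcard : Fintype.card W ^ T.card * (27 * E.card * e) < (collapsedHoms E T d H).card) :
    HasDenseFamily H (e + d) e := by
  obtain ⟨τ, -, hτ⟩ := Finset.exists_lt_card_fiber_of_mul_lt_card_of_maps_to
    (s := collapsedHoms E T d H) (t := (Finset.univ : Finset (T → W)))
    (f := fun φ a => φ a) (n := 27 * E.card * e) (fun _ _ => Finset.mem_univ _) (by simpa using hcard)
  refine hasDenseFamily_of_star hG hH hlin (Φ := _) ?_ ?_ ?_ ?_ hτ
  · exact fun φ hφ => (mem_collapsedHoms.1 (Finset.mem_filter.1 hφ).1).1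
  · intro φ hφ ψ hψ a ha
    exact congrFun ((Finset.mem_filter.1 hφ).2.trans (Finset.mem_filter.1 hψ).2.symm) ⟨a, ha⟩
  · exact fun φ hφ => (mem_collapsedHoms.1 (Finset.mem_filter.1 hφ).1).2.1
  · exact fun φ hφ => (mem_collapsedHoms.1 (Finset.mem_filter.1 hφ).1).2.2

/-- Pairs of homomorphisms agreeing on the glued set, and with a further coincidence, are few. -/
theorem IsPendant.card_coincident_pairs_le {E : Finset (Finset V)} {T : Finset V}
    {H : Finset (Finset W)} {d : ℕ} (hG : Gadget E T d) {z t : V} {f : Finset V}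
    (hz : IsPendant E T z t f) (hH : ∀ f ∈ H, f.card = 3) (hlin : IsLinearFamily H)
    (P : Finset ((V → W) × (V → W)))
    (hP : ∀ p ∈ P, IsEdgeHom E H p.1 ∧ IsEdgeHom E H p.2 ∧
      (∀ a ∈ insert z (T.erase t), p.1 a = p.2 a) ∧ ∃ v, p.1 v = p.2 t) :
    P.card ≤ Fintype.card W ^ d * Fintype.card V := by
  classical
  have hc : Fintype.card (({a // a ∈ insert z T} → W) × V) =
      Fintype.card W ^ d * Fintype.card V := by
    rw [Fintype.card_prod, Fintype.card_fun, Fintype.card_coe, hz.card_insert hG]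
  rw [← hc, ← Finset.card_univ]
  refine Finset.card_le_card_of_injOn
    -- The first map is coded by a spanning set of `d` vertices. The second agrees with it on the
    -- glued set, so only its value at `t` is missing, coded by a `v` with `p.1 v = p.2 t`; the
    -- default `t` is never reached on `P`.
    (fun p => (fun a => p.1 a.1, if h : ∃ v, p.1 v = p.2 t then h.choose else t))
    (fun _ _ => Finset.mem_coe.2 (Finset.mem_univ _)) ?_
  rintro ⟨φ₁, φ₂⟩ hφ ⟨ψ₁, ψ₂⟩ hψ heq
  obtain ⟨h1, h2, h3, h4⟩ := hP _ (Finset.mem_coe.1 hφ)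
  obtain ⟨k1, k2, k3, k4⟩ := hP _ (Finset.mem_coe.1 hψ)
  simp only [Prod.mk.injEq] at h1 h2 h3 h4 k1 k2 k3 k4 heq
  obtain ⟨e1, e2⟩ := heq
  have hfst : φ₁ = ψ₁ := h1.ext_of_spans k1 hG.card_edge hH hlin (hz.spans hG)
    fun a ha => congrFun e1 ⟨a, ha⟩
  subst hfst
  rw [dif_pos h4, dif_pos k4] at e2
  have ht : φ₂ t = ψ₂ t := by
    rw [← h4.choose_spec, ← k4.choose_spec, e2]
  have hsnd : φ₂ = ψ₂ := h2.ext_of_spans k2 hG.card_edge hH hlin (hz.spans hG) (by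
    intro a ha
    by_cases hat : a = t
    · rw [hat, ht]
    · have haS : a ∈ insert z (T.erase t) := by
        simp only [Finset.mem_insert, Finset.mem_erase] at ha ⊢
        tauto
      rw [← h3 a haS, k3 a haS])
  rw [hsnd]

variable {V' : Type*} [Fintype V'] [DecidableEq V'] {i j : V → V'}

/-- The number of injective homomorphisms of the double is at least about the square of the number
of injective homomorphisms, unless there are many collapsed homomorphisms. -/
theorem IsPendant.card_injHoms_sq_le {E : Finset (Finset V)} {T : Finset V}
    {H : Finset (Finset W)} {d : ℕ} (hG : Gadget E T d) {z t : V} {f : Finset V}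
    (hz : IsPendant E T z t f) (h : IsDouble (insert z (T.erase t)) i j)
    (hH : ∀ f ∈ H, f.card = 3) (hlin : IsLinearFamily H) :
    (injHoms E H).card ^ 2 ≤ Fintype.card W ^ (d - 1) *
      (Fintype.card W ^ d * Fintype.card V + (injHoms (doubleEdges E i j) H).card +
        (collapsedHoms (doubleEdges E i j) (insert (j t) (T.image i)) (d + 1) H).card) := by
  classical
  set S := insert z (T.erase t) with hS
  have hcS : S.card = d - 1 := by
    have := hz.card_glue hG
    rw [← hS] at this
    omega
  have h1 := card_sq_le_card_mul_card_pairs (injHoms E H) (fun φ (a : S) => φ a)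
  rw [Fintype.card_fun, Fintype.card_coe, hcS] at h1
  refine h1.trans (Nat.mul_le_mul_left _ ?_)
  set P := (injHoms E H ×ˢ injHoms E H).filter
    fun p => (fun a : S => p.1 a) = fun a : S => p.2 a with hP
  have hPmem : ∀ p ∈ P, p.1 ∈ injHoms E H ∧ p.2 ∈ injHoms E H ∧ ∀ a ∈ S, p.1 a = p.2 a := by
    intro p hp
    obtain ⟨h1, h2⟩ := Finset.mem_filter.1 hp
    obtain ⟨h3, h4⟩ := Finset.mem_product.1 h1
    exact ⟨h3, h4, fun a ha => congrFun h2 ⟨a, ha⟩⟩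
  -- Coincident pairs are counted directly; the others inject into the injective and collapsed maps
  -- of the double by gluing.
  rw [← Finset.card_filter_add_card_filter_not (s := P) (fun p => ∃ v, p.1 v = p.2 t), add_assoc]
  refine Nat.add_le_add (hz.card_coincident_pairs_le hG hH hlin _ ?_) ?_
  · intro p hp
    obtain ⟨h1, h2⟩ := Finset.mem_filter.1 hp
    obtain ⟨h3, h4, h5⟩ := hPmem p h1
    exact ⟨(mem_injHoms.1 h3).1, (mem_injHoms.1 h4).1, h5, h2⟩
  · refine le_trans ?_ (Finset.card_union_le _ _)
    have hex : ∀ p : (V → W) × (V → W), ∃ φ : V' → W, p ∈ P →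
        (∀ a, φ (i a) = p.1 a) ∧ ∀ a, φ (j a) = p.2 a := by
      intro p
      by_cases hp : p ∈ P
      · obtain ⟨φ, hφ⟩ := h.exists_glue (hPmem p hp).2.2
        exact ⟨φ, fun _ => hφ⟩
      · exact ⟨fun _ => p.1 z, fun h => absurd h hp⟩
    choose g hg using hex
    refine Finset.card_le_card_of_injOn g ?_ ?_
    · intro p hp
      obtain ⟨h1, h2⟩ := Finset.mem_filter.1 (Finset.mem_coe.1 hp)
      obtain ⟨h3, h4, h5⟩ := hPmem p h1
      obtain ⟨g1, g2⟩ := hg p h1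
      have c1 : g p ∘ i = p.1 := funext g1
      have c2 : g p ∘ j = p.2 := funext g2
      rw [mem_injHoms] at h3 h4
      have hhom : IsEdgeHom (doubleEdges E i j) H (g p) := by
        intro f' hf'
        rcases mem_doubleEdges.1 hf' with ⟨f'', hf'', rfl⟩ | ⟨f'', hf'', rfl⟩
        · rw [Finset.image_image, c1]
          exact h3.1 f'' hf''
        · rw [Finset.image_image, c2]
          exact h4.1 f'' hf''
      have ht : ∀ v, g p (i v) ≠ g p (j t) := by
        intro v hv
        rw [g1, g2] at hv
        exact h2 ⟨v, hv⟩
      rw [Finset.mem_coe, Finset.mem_union]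
      rcases hz.injective_or_card_image_le hG h hH (φ := g p) (c2 ▸ h4.1) (c1 ▸ h3.2) (c2 ▸ h4.2)
        ht with hinj | hfew
      · exact Or.inl (mem_injHoms.2 ⟨hhom, hinj⟩)
      · refine Or.inr (mem_collapsedHoms.2 ⟨hhom, ?_, by omega⟩)
        rw [Finset.coe_insert, Finset.coe_image, Set.injOn_insert]
        · refine ⟨?_, ?_⟩
          · rintro _ ⟨a, -, rfl⟩ _ ⟨b, -, rfl⟩ hab
            rw [g1, g1] at hab
            rw [h3.2 hab]
          · rintro ⟨_, ⟨a, -, rfl⟩, ha⟩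
            exact ht a ha
        · rintro ⟨a, -, ha⟩
          exact ht a (by rw [ha])
    · intro p hp q hq hpq
      obtain ⟨g1, g2⟩ := hg p (Finset.mem_filter.1 (Finset.mem_coe.1 hp)).1
      obtain ⟨k1, k2⟩ := hg q (Finset.mem_filter.1 (Finset.mem_coe.1 hq)).1
      refine Prod.ext (funext fun a => ?_) (funext fun a => ?_)
      · rw [← g1, ← k1, hpq]
      · rw [← g2, ← k2, hpq]

end Counting

/-- In a linear `3`-graph with at least `C n ^ 2 / y` edges there are `e` edges on at most `v`
vertices, or at least `L n ^ d / y ^ (2 ^ k)` injective homomorphisms from `E`. -/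
def IsAbundant.{u} {V : Type*} [Fintype V] [DecidableEq V] (E : Finset (Finset V))
    (d k v e : ℕ) : Prop :=
  ∀ L : ℝ, ∃ C : ℝ, ∀ (W : Type u) [Fintype W] [DecidableEq W] (H : Finset (Finset W)) (y : ℝ),
    (∀ f ∈ H, f.card = 3) → IsLinearFamily H → 1 ≤ y → y ^ 2 ^ k ≤ Fintype.card W →
    C * ((Fintype.card W : ℝ) ^ 2 / y) ≤ H.card →
    HasDenseFamily H v e ∨
      L * ((Fintype.card W : ℝ) ^ d / y ^ 2 ^ k) ≤ (injHoms E H).card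

/-- Squaring gives `(L' n ^ d / Y) ^ 2 / n ^ (d - 1) = L' ^ 2 n ^ (d + 1) / Y ^ 2`. The freedom in
the constant `L` pays for the error terms at each doubling. -/
theorem IsPendant.isAbundant_double.{u, v₁, v₂} {V : Type v₁} {V' : Type v₂} [Fintype V] [DecidableEq V] [Fintype V']
    [DecidableEq V'] {i j : V → V'} {E : Finset (Finset V)} {T : Finset V} {d k v e : ℕ}
    (hG : Gadget E T d) {z t z' t' : V} {f f' : Finset V} (hne : z ≠ z')
    (hz : IsPendant E T z t f) (hz' : IsPendant E T z' t' f')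
    (h : IsDouble (insert z (T.erase t)) i j) (hA : IsAbundant.{u} E d k v e)
    (hv : e + (d + 1) ≤ v) : IsAbundant.{u} (doubleEdges E i j) (d + 1) (k + 1) v e := by
  intro L
  obtain ⟨hG', -⟩ := hG.double hne hz hz' h
  set M := 27 * (doubleEdges E i j).card * e
  -- The terms `|V|` and `M` absorb coincident and collapsed pairs; the `1` ensures `L' ≤ L' ^ 2`.
  set L' : ℝ := |L| + Fintype.card V + M + 1 with hL'
  obtain ⟨C, hC⟩ := hA L'
  refine ⟨C, fun W _ _ H y hH hlin hy hyn hHC => ?_⟩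
  have hyk : y ^ 2 ^ k ≤ Fintype.card W :=
    (pow_le_pow_right₀ hy (Nat.pow_le_pow_right two_pos k.le_succ)).trans hyn
  rcases hC W H y hH hlin hy hyk hHC with hd | hinj
  · exact Or.inl hd
  rcases Nat.lt_or_ge (Fintype.card W ^ (insert (j t) (T.image i)).card * M)
    (collapsedHoms (doubleEdges E i j) (insert (j t) (T.image i)) (d + 1) H).card with hbig | hsmall
  · exact Or.inl ((hasDenseFamily_of_card_collapsedHoms hG' hH hlin hbig).mono subset_rfl hv)
  right
  have hroot : (insert (j t) (T.image i)).card = d := by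
    have := hG'.card_root
    omega
  rw [hroot] at hsmall
  have hsq := hz.card_injHoms_sq_le hG h hH hlin
  set N : ℝ := (Fintype.card W : ℝ) with hN
  set Y : ℝ := y ^ 2 ^ k with hY
  have hY1 : 1 ≤ Y := one_le_pow₀ hy
  have hYY : y ^ 2 ^ (k + 1) = Y ^ 2 := by rw [hY, pow_succ, pow_mul]
  rw [hYY] at hyn ⊢
  have hN1 : 1 ≤ N := (one_le_pow₀ hY1).trans hyn
  have hd1 : 1 ≤ d := by
    have := hG.card_root
    omega
  obtain ⟨c, rfl⟩ : ∃ c, d = c + 1 := ⟨d - 1, by omega⟩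
  rw [Nat.add_sub_cancel] at hsq
  set I : ℝ := ((injHoms (doubleEdges E i j) H).card : ℝ) with hI
  set X : ℝ := N ^ (c + 1 + 1) / Y ^ 2 with hX
  -- Here `Y ^ 2 ≤ N` makes the errors of order `N ^ d` no larger than the main term.
  have hXN : N ^ (c + 1) ≤ X := by
    rw [hX, le_div_iff₀ (by positivity), pow_succ N (c + 1)]
    exact mul_le_mul_of_nonneg_left hyn (by positivity)
  have hL'0 : 1 ≤ L' := by
    have := abs_nonneg L
    have h2 : (0 : ℝ) ≤ Fintype.card V := by positivity
    have h3 : (0 : ℝ) ≤ M := by positivity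
    linarith
  have hsqR : ((injHoms E H).card : ℝ) ^ 2 ≤ N ^ c * (N ^ (c + 1) * Fintype.card V + I +
      N ^ (c + 1) * M) := by
    have h2 : (injHoms E H).card ^ 2 ≤ Fintype.card W ^ c * (Fintype.card W ^ (c + 1) *
        Fintype.card V + (injHoms (doubleEdges E i j) H).card +
        Fintype.card W ^ (c + 1) * M) :=
      hsq.trans (Nat.mul_le_mul_left _ (Nat.add_le_add_left hsmall _))
    rw [hN, hI]
    exact_mod_cast h2
  have hlow : N ^ c * (L' ^ 2 * X) ≤ N ^ c * (N ^ (c + 1) * Fintype.card V + I +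
      N ^ (c + 1) * M) := by
    refine le_trans (le_of_eq ?_) ((pow_le_pow_left₀ (by positivity) hinj 2).trans hsqR)
    rw [hX]
    field_simp
    ring
  have hlow' := le_of_mul_le_mul_left hlow (by positivity)
  have hXpos : 0 ≤ X := by positivity
  have b1 : N ^ (c + 1) * Fintype.card V ≤ X * Fintype.card V :=
    mul_le_mul_of_nonneg_right hXN (by positivity)
  have b2 : N ^ (c + 1) * (M : ℝ) ≤ X * M := mul_le_mul_of_nonneg_right hXN (by positivity)
  have b3 : L' * X ≤ L' ^ 2 * X := by
    refine mul_le_mul_of_nonneg_right ?_ hXpos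
    nlinarith
  have b4 : L * X ≤ |L| * X := mul_le_mul_of_nonneg_right (le_abs_self L) hXpos
  have b5 : L' * X = |L| * X + X * Fintype.card V + X * M + X := by rw [hL']; ring
  linarith

/-! ### Iterating the doubling from a single edge -/

section Existence

theorem gadget_edge : Gadget {(Finset.univ : Finset (Fin 3))} {0} 2 where
  card_edge := by simp
  card_root := by simp
  card_vertex := by simp
  nonempty := by simp
  spans f hf := fun X hX _ v => by
    rw [Finset.mem_singleton.1 hf] at hX
    exact hX (Finset.mem_union_right _ (Finset.mem_univ v))
  card_inter_le f hf := by
    rw [Finset.mem_singleton.1 hf]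
    decide
  pendant := by
    refine ⟨1, 0, Finset.univ, 2, 0, Finset.univ, by decide, ?_, ?_⟩ <;>
      exact ⟨by decide, by simp, by simp, by simp, by simp, by simp⟩

theorem isAbundant_edge.{u} (v e : ℕ) :
    IsAbundant.{u} {(Finset.univ : Finset (Fin 3))} 2 0 v e := by
  refine fun L => ⟨L, fun W _ _ H y hH _ _ _ hHC => Or.inr ?_⟩
  rw [pow_zero, pow_one]
  refine hHC.trans ?_
  rw [Nat.cast_le]
  refine Finset.card_le_card_of_surjOn (fun φ => Finset.univ.image φ) ?_
  intro f hf
  have hc : f.card = 3 := hH f (Finset.mem_coe.1 hf)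
  set φ : Fin 3 → W := fun a => (f.equivFinOfCardEq hc).symm a with hφ
  have hinj : Function.Injective φ :=
    Subtype.val_injective.comp (f.equivFinOfCardEq hc).symm.injective
  have himg : Finset.univ.image φ = f := by
    refine Finset.eq_of_subset_of_card_le ?_ ?_
    · intro w hw
      obtain ⟨a, -, rfl⟩ := Finset.mem_image.1 hw
      exact ((f.equivFinOfCardEq hc).symm a).2
    · rw [Finset.card_image_of_injective _ hinj, hc]
      simp
  refine ⟨φ, Finset.mem_coe.2 (mem_injHoms.2 ⟨?_, hinj⟩), himg⟩
  intro g hg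
  rw [Finset.mem_singleton.1 hg, himg]
  exact hf

/-- The target `v` stays fixed throughout: the dense families met at earlier stages have smaller
excess and also fit. -/
theorem exists_gadget_isAbundant.{u} (v e : ℕ) (k : ℕ) (hk : e + (k + 2) ≤ v) :
    ∃ (V : Type) (_ : Fintype V) (_ : DecidableEq V) (E : Finset (Finset V)) (T : Finset V),
      Gadget E T (k + 2) ∧ E.card = 2 ^ k ∧ IsAbundant.{u} E (k + 2) k v e := by
  induction k with
  | zero => exact ⟨Fin 3, inferInstance, inferInstance, _, _, gadget_edge, by simp,
      isAbundant_edge v e⟩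
  | succ k ih =>
    obtain ⟨V, _, _, E, T, hG, hc, hA⟩ := ih (by omega)
    obtain ⟨z, t, f, z', t', f', hne, hz, hz'⟩ := hG.pendant
    obtain ⟨i, j, hij⟩ := exists_isDouble (insert z (T.erase t))
    obtain ⟨h1, h2⟩ := hG.double hne hz hz' hij
    refine ⟨_, inferInstance, inferInstance, _, _, h1, by rw [h2, hc, pow_succ'], ?_⟩
    exact IsPendant.isAbundant_double hG hne hz hz' hij hA (by omega)

/-- A linear `3`-graph with at least `C n ^ 2 / y` edges, where `y ^ (2 ^ k) ≤ n` and `e ≤ 2 ^ k`,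
has `e` edges on at most `e + k + 2` vertices. -/
theorem exists_forall_isLinearFamily_hasDenseFamily.{u} {e k : ℕ} (hk : e ≤ 2 ^ k) :
    ∃ C : ℝ, ∀ (W : Type u) [Fintype W] [DecidableEq W] (H : Finset (Finset W)) (y : ℝ),
      (∀ f ∈ H, f.card = 3) → IsLinearFamily H → 1 ≤ y → y ^ 2 ^ k ≤ Fintype.card W →
      C * ((Fintype.card W : ℝ) ^ 2 / y) ≤ H.card → HasDenseFamily H (e + (k + 2)) e := by
  obtain ⟨V, _, _, E, T, hG, hc, hA⟩ := exists_gadget_isAbundant.{u} (e + (k + 2)) e k le_rfl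
  obtain ⟨C, hC⟩ := hA 1
  refine ⟨C, fun W _ _ H y hH hlin hy hyn hHC => ?_⟩
  rcases hC W H y hH hlin hy hyn hHC with hd | hinj
  · exact hd
  have hy0 : 0 < y ^ 2 ^ k := by positivity
  have hW : (0 : ℝ) < Fintype.card W := hy0.trans_le hyn
  have hpos : (0 : ℝ) < (injHoms E H).card := lt_of_lt_of_le (by positivity) hinj
  obtain ⟨φ, hφ⟩ := Finset.card_pos.1 (Nat.cast_pos.1 hpos)
  obtain ⟨hφ, hφi⟩ := mem_injHoms.1 hφ
  obtain ⟨z, t, f, -, -, -, -, hz, -⟩ := hG.pendant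
  -- The injective image has `2 ^ k ≥ e` edges; `e` of them are collected singly from a spanning set
  -- of `k + 2` vertices.
  obtain ⟨G, hG', hGc, hGu⟩ := hφ.exists_subfamily hG.card_edge hH (hz.spans hG) subset_rfl
    (j := e) (by
      rwa [imageEdges, Finset.card_image_of_injective _ (Finset.image_injective hφi), hc])
  refine ⟨G, hG'.trans hφ.imageEdges_subset, hGc, ?_⟩
  have h1 := (Finset.card_le_card Finset.subset_union_right).trans hGu
  have h2 : ((insert z T).image φ).card ≤ k + 2 :=
    Finset.card_image_le.trans (hz.card_insert hG).le
  omega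

end Existence

/-! ### Reduction to linear `3`-graphs -/

section Linear

variable {W : Type*} [DecidableEq W]

/-- Many edges through a pair of vertices form a dense family. -/
theorem hasDenseFamily_of_le_card_filter {H : Finset (Finset W)} (hH : ∀ f ∈ H, f.card = 3)
    {p : Finset W} (hp : p.card = 2) {e : ℕ} (he : e ≤ (H.filter fun f => p ⊆ f).card) :
    HasDenseFamily H (e + 2) e := by
  obtain ⟨E, hE, hc⟩ := Finset.exists_subset_card_eq he
  refine ⟨E, hE.trans (Finset.filter_subset _ _), hc, ?_⟩
  have h1 : E.biUnion id ⊆ p ∪ E.biUnion fun f => f \ p := by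
    intro w hw
    obtain ⟨f, hf, hwf⟩ := Finset.mem_biUnion.1 hw
    by_cases hwp : w ∈ p
    · exact Finset.mem_union_left _ hwp
    · exact Finset.mem_union_right _ (Finset.mem_biUnion.2 ⟨f, hf, Finset.mem_sdiff.2 ⟨hwf, hwp⟩⟩)
  have h2 : (E.biUnion fun f => f \ p).card ≤ E.card * 1 := by
    refine Finset.card_biUnion_le_card_mul _ _ 1 fun f hf => ?_
    obtain ⟨h3, h4⟩ := Finset.mem_filter.1 (hE hf)
    rw [Finset.card_sdiff_of_subset h4, hH f h3, hp]
  have h3 := (Finset.card_le_card h1).trans (Finset.card_union_le _ _)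
  omega

/-- A `3`-graph in which every pair lies in at most `c` edges has a linear subfamily that contains
at least a proportion `1 / (3 c)` of the edges. -/
theorem exists_isLinearFamily_subset {H : Finset (Finset W)} (hH : ∀ f ∈ H, f.card = 3) {c : ℕ}
    (hc : ∀ p : Finset W, p.card = 2 → (H.filter fun f => p ⊆ f).card ≤ c) :
    ∃ H' ⊆ H, IsLinearFamily H' ∧ H.card ≤ H'.card * (3 * c) := by
  classical
  obtain ⟨H', hH', hmax⟩ := Finset.exists_max_image (H.powerset.filter IsLinearFamily) Finset.card
    ⟨∅, Finset.mem_filter.2 ⟨by simp, by simp [IsLinearFamily]⟩⟩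
  obtain ⟨hsub, hlin⟩ := Finset.mem_filter.1 hH'
  rw [Finset.mem_powerset] at hsub
  refine ⟨H', hsub, hlin, ?_⟩
  -- By maximality of `H'`, each edge shares a pair with a member of `H'`; a member has three pairs,
  -- each in at most `c` edges.
  have hcover : H ⊆ H'.biUnion fun g => H.filter fun f => 2 ≤ (g ∩ f).card := by
    intro f hf
    by_contra hno
    have hno' : ∀ g ∈ H', (g ∩ f).card < 2 := by
      intro g hg
      by_contra! h2
      exact hno (Finset.mem_biUnion.2 ⟨g, hg, Finset.mem_filter.2 ⟨hf, h2⟩⟩)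
    have hfH' : f ∉ H' := by
      intro hfH'
      have := hno' f hfH'
      rw [Finset.inter_self, hH f hf] at this
      omega
    have hins : IsLinearFamily (insert f H') := by
      intro A hA B hB h2
      rcases Finset.mem_insert.1 hA with rfl | hA' <;> rcases Finset.mem_insert.1 hB with rfl | hB'
      · rfl
      · rw [Finset.inter_comm] at h2
        exact absurd h2 (not_le.2 (hno' B hB'))
      · exact absurd h2 (not_le.2 (hno' A hA'))
      · exact hlin A hA' B hB' h2
    have := hmax (insert f H') (Finset.mem_filter.2
      ⟨Finset.mem_powerset.2 (Finset.insert_subset hf hsub), hins⟩)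
    rw [Finset.card_insert_of_notMem hfH'] at this
    omega
  refine (Finset.card_le_card hcover).trans (Finset.card_biUnion_le_card_mul _ _ _ ?_)
  intro g hg
  have hpairs : (H.filter fun f => 2 ≤ (g ∩ f).card) ⊆
      (g.powersetCard 2).biUnion fun p => H.filter fun f => p ⊆ f := by
    intro f hf
    obtain ⟨h1, h2⟩ := Finset.mem_filter.1 hf
    obtain ⟨p, hp, hpc⟩ := Finset.exists_subset_card_eq h2
    exact Finset.mem_biUnion.2 ⟨p, Finset.mem_powersetCard.2
      ⟨hp.trans Finset.inter_subset_left, hpc⟩,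
      Finset.mem_filter.2 ⟨h1, hp.trans Finset.inter_subset_right⟩⟩
  refine (Finset.card_le_card hpairs).trans ((Finset.card_biUnion_le_card_mul _ _ c
    fun p hp => hc p (Finset.mem_powersetCard.1 hp).2).trans (le_of_eq ?_))
  rw [Finset.card_powersetCard, hH g (hsub hg)]
  rfl

end Linear

/-- A `3`-graph with at least `C n ^ (2 - 2 ^ (-k))` edges, where `e ≤ 2 ^ k`, has `e` edges on at
most `e + k + 2` vertices. -/
theorem exists_forall_hasDenseFamily.{u} {e k : ℕ} (he : 0 < e) (hk : e ≤ 2 ^ k) :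
    ∃ C : ℝ, 0 < C ∧ ∀ (W : Type u) [Fintype W] [DecidableEq W] [Nonempty W]
      (H : Finset (Finset W)), (∀ f ∈ H, f.card = 3) →
      C * (Fintype.card W : ℝ) ^ (2 - ((2 : ℝ) ^ k)⁻¹) ≤ H.card →
      HasDenseFamily H (e + (k + 2)) e := by
  obtain ⟨C, hC⟩ := exists_forall_isLinearFamily_hasDenseFamily.{u} hk
  -- The factor `3 e` is the loss in passing to a linear subfamily; `|C| + 1`-type padding makes the
  -- constant positive whatever the sign of `C`.
  refine ⟨3 * e * |C| + 1, by positivity, fun W _ _ _ H hH hHC => ?_⟩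
  by_cases hcod : ∃ p : Finset W, p.card = 2 ∧ e ≤ (H.filter fun f => p ⊆ f).card
  · obtain ⟨p, hp, hpe⟩ := hcod
    exact (hasDenseFamily_of_le_card_filter hH hp hpe).mono subset_rfl (by omega)
  push Not at hcod
  obtain ⟨H', hsub, hlin, hcard⟩ := exists_isLinearFamily_subset hH fun p hp => (hcod p hp).le
  set N : ℝ := (Fintype.card W : ℝ) with hN
  have hN1 : 1 ≤ N := by
    rw [hN, Nat.one_le_cast]
    exact Fintype.card_pos
  have hN0 : 0 < N := by linarith
  set ε : ℝ := ((2 : ℝ) ^ k)⁻¹ with hε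
  refine HasDenseFamily.mono ?_ hsub le_rfl
  -- With `y = N ^ ε`, `y ^ (2 ^ k)` equals `N`, the largest value allowed.
  refine hC W H' (N ^ ε) (fun f hf => hH f (hsub hf)) hlin
    (Real.one_le_rpow hN1 (by positivity)) (le_of_eq ?_) ?_
  · rw [← Real.rpow_natCast, ← Real.rpow_mul hN0.le, hε]
    push_cast
    rw [inv_mul_cancel₀ (by positivity), Real.rpow_one]
  · have hpow : N ^ 2 / N ^ ε = N ^ (2 - ε) := by
      rw [Real.rpow_sub hN0, Real.rpow_two]
    rw [← hN, hpow]
    have hX : 0 ≤ N ^ (2 - ε) := by positivity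
    have hcard' : (H.card : ℝ) ≤ H'.card * (3 * e) := by exact_mod_cast hcard
    have he' : (0 : ℝ) < 3 * e := by positivity
    have h1 : C * N ^ (2 - ε) ≤ |C| * N ^ (2 - ε) := mul_le_mul_of_nonneg_right (le_abs_self C) hX
    refine h1.trans (le_of_mul_le_mul_right ?_ he')
    linarith

theorem mainTheorem1 (e : ℕ) (he : 3 ≤ e) :
    ∃ ε : ℝ, 0 < ε ∧
      (fun n : ℕ => (brownErdosSos n (e + Nat.log 2 e + 38) e : ℝ))
        =O[Filter.atTop] (fun n : ℕ => (n : ℝ) ^ (2 - ε)) ∧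
      ∃ C : ℝ, 0 < C ∧
        ∀ (V : Type*) [Fintype V] [DecidableEq V] [Nonempty V] (H : Finset (Finset V)),
          IsThreeUniform H →
          C * (Fintype.card V : ℝ) ^ (2 - ε) ≤ (H.card : ℝ) →
          ∃ E : Finset (Finset V), E ⊆ H ∧ E.card = e ∧
            (E.biUnion id).card ≤ e + Nat.log 2 e + 38 := by
  -- Taking `k = Nat.log 2 e + 1` gives excess `Nat.log 2 e + 3`, well within the stated bound.
  have hk : e ≤ 2 ^ (Nat.log 2 e + 1) := (Nat.lt_pow_succ_log_self one_lt_two e).le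
  have he0 : 0 < e := by omega
  have hv : e + (Nat.log 2 e + 1 + 2) ≤ e + Nat.log 2 e + 38 := by omega
  refine ⟨((2 : ℝ) ^ (Nat.log 2 e + 1))⁻¹, by positivity, ?_, ?_⟩
  · obtain ⟨C, -, hC⟩ := exists_forall_hasDenseFamily he0 hk
    refine Asymptotics.IsBigO.of_bound C ?_
    filter_upwards [Filter.eventually_ge_atTop 1] with n hn
    rw [Real.norm_of_nonneg (by positivity), Real.norm_of_nonneg (by positivity)]
    obtain ⟨⟨H, hH, hno, hcard⟩, -⟩ :=
      isGreatest_brownErdosSos n (e + Nat.log 2 e + 38) e (by omega)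
    have : Nonempty (Fin n) := ⟨⟨0, hn⟩⟩
    rw [← hcard]
    by_contra! hlt
    obtain ⟨E, hE, hEc, hEu⟩ := hC (Fin n) H (fun f hf => hH (Finset.mem_coe.2 hf))
      (by rw [Fintype.card_fin]; exact hlt.le)
    exact hno ⟨E.biUnion id, E, hE, fun A hA => Finset.subset_biUnion_of_mem id hA,
      hEu.trans hv, hEc.ge⟩
  · obtain ⟨C, hC0, hC⟩ := exists_forall_hasDenseFamily he0 hk
    refine ⟨C, hC0, fun V _ _ _ H hH hHC => ?_⟩
    exact (hC V H (fun f hf => hH (Finset.mem_coe.2 hf)) hHC).mono subset_rfl hv
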